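/- Let $\omega_1,\omega_2\in\mathbb{R}$ be linearly independent over $\mathbb{Z}$ and let $L=\mathbb{Z}\omega_1+\mathbb{Z}\omega_2\subset\mathbb{R}\subset\mathbb{C}$ (a pseudolattice). Let $\mathcal{H}$ be the ring of entire functions on $\mathbb{C}$, let $\mathcal{H}^*$ be its group of units (the nowhere vanishing entire functions), and let $Z^1(L,\mathcal{H}^*)$ be the group of families $A=(A_l)_{l\in L}$ in $\mathcal{H}^*$ with $A_{l+l'}(v)=A_l(v+l')A_{l'}(v)$ for all $l,l'\in L$, $v\in\mathbb{C}$. Let $A\in Z^1(L,\mathcal{H}^*)$, and let $\Theta$ be a holomorphic theta function for $A$, that is, an entire function with $\Theta(v+l)=A_l(v)\Theta(v)$ for all $l\in L$, $v\in\mathbb{C}$. Suppose that $\Theta$ is not identically zero. Then $\Theta$ is trivial, in the following sense. 1. $\Theta$ is a nonzero constant multiple of an exponential: $\Theta(v)=c\,e^{g(v)}$ with $c\in\mathbb{C}^*$ and $g$ entire. 2. Call a family $(B_l)_{l\in L}$ in $\mathcal{H}^*$ normalised if there are a homomorphism $\mu:L\to U(1)$ and an integer $s$ such that $B_l(v)=\mu(l)\,e^{\frac{s\pi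 i}{\omega_1}(b^2\omega_2+2bv)}$ for all $l=a\omega_1+b\omega_2\in L$ ($a,b\in\mathbb{Z}$) and all $v\in\mathbb{C}$. For $h\in\mathcal{H}^*$, the function $\Theta h$ is a theta function for the cohomologous cocycle $B_l(v)=A_l(v)h(v+l)/h(v)$. There is an $h\in\mathcal{H}^*$ for which this cocycle is normalised; and for every such $h$ there are $c\in\mathbb{C}^*$ and $\alpha\in\mathbb{R}$ with $\Theta(v)h(v)=c\,e^{2\pi i\alpha v}$ for all $v\in\mathbb{C}$. (In particular, if $A$ itself is normalised, then $\Theta(v)=c\,e^{2\pi i\alpha v}$.) -/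

import Mathlib

namespace QuantumTheta

/-- The ring `𝓗` of entire functions `ℂ → ℂ`, with pointwise operations. -/
def entireRing : Subring (ℂ → ℂ) where
  carrier := {f | Differentiable ℂ f}
  mul_mem' := fun hf hg => Differentiable.mul hf hg
  one_mem' := differentiable_const (1 : ℂ)
  add_mem' := fun hf hg => Differentiable.add hf hg
  zero_mem' := differentiable_const (0 : ℂ)
  neg_mem' := fun hf => Differentiable.neg hf

/-- The multiplicative group `𝓗^*` of units of `𝓗` (nowhere vanishing entire functions). -/
abbrev EntireUnits : Type := entireRingˣ

/-- The value of `f ∈ 𝓗^*` at a point. -/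
def EntireUnits.eval (f : EntireUnits) (v : ℂ) : ℂ :=
  ((f : entireRing) : ℂ → ℂ) v

/-- Translation `f ↦ f (· + w)` as a ring endomorphism of `𝓗`. -/
def translate (w : ℂ) : entireRing →+* entireRing where
  toFun f := ⟨fun v => (f : ℂ → ℂ) (v + w),
    Differentiable.comp (g := (f : ℂ → ℂ)) f.2 (differentiable_id.add_const w)⟩
  map_one' := rfl
  map_mul' _ _ := rfl
  map_zero' := rfl
  map_add' _ _ := rfl

/-- Translation `f ↦ f (· + w)` on the group `𝓗^*`. -/
def translateUnits (w : ℂ) : EntireUnits →* EntireUnits :=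
  Units.map (translate w).toMonoidHom

/-- The group `Z¹(G, 𝓗^*)` of 1-cocycles of a subgroup `G ⊆ ℂ` acting on `𝓗^*` by translation:
families `A` with `A_{g+g'}(v) = A_g(v + g') A_{g'}(v)`. -/
def cocycles (G : AddSubgroup ℂ) : Subgroup (G → EntireUnits) where
  carrier := {A | ∀ g g' : G, A (g + g') = translateUnits (g' : ℂ) (A g) * A g'}
  one_mem' := by intro g g'; simp
  mul_mem' := by
    intro A B hA hB g g'
    simp only [Pi.mul_apply, hA g g', hB g g', map_mul]
    exact mul_mul_mul_comm _ _ _ _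
  inv_mem' := by
    intro A hA g g'
    simp only [Pi.inv_apply, hA g g', map_inv, mul_inv]

/-- `Θ` is a holomorphic theta function for the family `A` of multipliers:
`Θ` is entire and `Θ(v + g) = A_g(v) Θ(v)` for all `g ∈ G` and `v ∈ ℂ`. -/
def IsThetaFor {G : AddSubgroup ℂ} (A : G → EntireUnits) (Θ : ℂ → ℂ) : Prop :=
  Differentiable ℂ Θ ∧ ∀ (g : G) (v : ℂ), Θ (v + g) = (A g).eval v * Θ v

/-- A trivial theta function: a nonzero multiple of the exponential of an entire function. -/
def IsTrivialTheta (Θ : ℂ → ℂ) : Prop :=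
  ∃ (c : ℂ) (g : ℂ → ℂ), c ≠ 0 ∧ Differentiable ℂ g ∧ ∀ v, Θ v = c * Complex.exp (g v)

/-- The cohomologous family `B_l(v) = A_l(v) h(v + l) / h(v)`, for `h ∈ 𝓗^*`. -/
def twist {G : AddSubgroup ℂ} (h : EntireUnits) (A : G → EntireUnits) : G → EntireUnits :=
  fun l => A l * translateUnits (l : ℂ) h / h

/-- The subgroup `ℤω₁ + ℤω₂` of `ℝ`, viewed inside `ℂ`. -/
def pseudolattice (ω₁ ω₂ : ℝ) : AddSubgroup ℂ :=
  AddSubgroup.closure {(ω₁ : ℂ), (ω₂ : ℂ)}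

/-- Normalised multipliers on `L = ℤω₁ + ℤω₂`: for some unitary character `μ` of `L` and some
integer `s`, `B_l(v) = μ(l) exp((s π i / ω₁) (b² ω₂ + 2 b v))` whenever `l = a ω₁ + b ω₂`. -/
def IsNormalized (ω₁ ω₂ : ℝ) (B : pseudolattice ω₁ ω₂ → EntireUnits) : Prop :=
  ∃ (μ : AddChar (pseudolattice ω₁ ω₂) Circle) (s : ℤ),
    ∀ (l : pseudolattice ω₁ ω₂) (a b : ℤ), (l : ℂ) = a * ω₁ + b * ω₂ → ∀ v : ℂ,
      (B l).eval v = (μ l : ℂ) *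
        Complex.exp (s * (Real.pi * Complex.I / ω₁) * ((b : ℂ) ^ 2 * ω₂ + 2 * b * v))

end QuantumTheta

namespace QuantumTheta

open Filter Topology

/-! `L` is dense in `ℝ`, so an entire function constant on a translate of `L` is constant
(`eq_const_of_eq_on_pseudolattice`). A zero of `Θ` propagates along such a translate, hence `Θ` has
none and is `exp g`. For normalised multipliers, `g'` is additively quasi-periodic under `L`;
boundedness on `ℝ` makes it periodic (`quasiperiod_eq_zero`), and density makes it constant.
Unitarity of `μ` then makes this constant imaginary. -/

theorem mem_pseudolattice (ω₁ ω₂ : ℝ) (a b : ℤ) :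
    (a * ω₁ + b * ω₂ : ℂ) ∈ pseudolattice ω₁ ω₂ := by
  rw [pseudolattice, AddSubgroup.mem_closure_pair]
  exact ⟨a, b, by simp⟩

theorem left_ne_zero_of_linearIndependent {ω₁ ω₂ : ℝ} (hω : LinearIndependent ℤ ![ω₁, ω₂]) :
    ω₁ ≠ 0 := hω.ne_zero 0

theorem dense_int_combinations {ω₁ ω₂ : ℝ} (hω : LinearIndependent ℤ ![ω₁, ω₂]) :
    Dense {x : ℝ | ∃ a b : ℤ, x = a * ω₁ + b * ω₂} := by
  have hirr : Irrational (ω₁ / ω₂) := by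
    have h₂ : ω₂ ≠ 0 := hω.ne_zero 1
    rw [LinearIndependent.pair_iff] at hω
    -- A rational ratio gives the relation `q.den * ω₁ - q.num * ω₂ = 0`.
    rintro ⟨q, hq⟩
    have h := (hω q.den (-q.num) ?_).1
    · exact q.den_ne_zero (by exact_mod_cast h)
    · rw [eq_div_iff h₂, Rat.cast_def] at hq
      have hd : (q.den : ℝ) ≠ 0 := by exact_mod_cast q.den_ne_zero
      rw [← hq]
      simp only [zsmul_eq_mul]
      push_cast
      field_simp
      ring
  refine (dense_addSubgroupClosure_pair_iff.2 hirr).mono ?_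
  intro x hx
  obtain ⟨a, b, h⟩ := AddSubgroup.mem_closure_pair.1 hx
  exact ⟨a, b, by simpa using h.symm⟩

/-- An entire function that is constant on a translate of a pseudolattice is constant. -/
theorem eq_const_of_eq_on_pseudolattice {ω₁ ω₂ : ℝ} (hω : LinearIndependent ℤ ![ω₁, ω₂])
    {f : ℂ → ℂ} (hf : Differentiable ℂ f) (z c : ℂ)
    (h : ∀ a b : ℤ, f (z + (a * ω₁ + b * ω₂)) = c) (v : ℂ) : f v = c := by
  have hreal : ∀ x : ℝ, f (z + x) = c := by
    have hcont : Continuous fun x : ℝ => f (z + x) :=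
      hf.continuous.comp (continuous_const.add Complex.continuous_ofReal)
    refine fun x => congrFun (hcont.ext_on (dense_int_combinations hω) continuous_const ?_) x
    rintro _ ⟨a, b, rfl⟩
    simpa using h a b
  -- The real line through `z` accumulates at `z`, so the identity theorem applies.
  have hfreq : ∃ᶠ w in 𝓝[≠] z, f w = c := by
    have ht : Tendsto (fun x : ℝ => z + (x : ℂ)) (𝓝[≠] 0) (𝓝[≠] z) := by
      refine tendsto_nhdsWithin_iff.2 ⟨?_, ?_⟩
      · have : Continuous fun x : ℝ => z + (x : ℂ) :=
          continuous_const.add Complex.continuous_ofReal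
        simpa using (this.tendsto 0).mono_left nhdsWithin_le_nhds
      · filter_upwards [self_mem_nhdsWithin] with x hx
        simpa using hx
    exact ht.frequently (Frequently.of_forall hreal)
  exact congrFun (AnalyticOnNhd.eq_of_frequently_eq (g := fun _ => c) (z₀ := z)
    (fun w _ => hf.analyticAt w) (fun _ _ => analyticAt_const) hfreq) v

/-- A nowhere vanishing entire function has an entire logarithm. -/
theorem exists_entire_log {f : ℂ → ℂ} (hf : Differentiable ℂ f) (h0 : ∀ v, f v ≠ 0) :
    ∃ g : ℂ → ℂ, Differentiable ℂ g ∧ ∀ v, f v = Complex.exp (g v) := by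
  have hq : Differentiable ℂ fun v => deriv f v / f v :=
    hf.deriv.div hf h0
  -- A primitive of `f'/f`, normalised at `0` so that the constant `f * exp (-g)` equals `1`.
  obtain ⟨g, hg⟩ := hq.isExactOn_univ.with_val_at 0 (Complex.log (f 0))
  have hg' : ∀ v, HasDerivAt g (deriv f v / f v) v := fun v => hg.2 v (Set.mem_univ v)
  refine ⟨g, fun v => (hg' v).differentiableAt, fun v => ?_⟩
  have hd : ∀ w, HasDerivAt (fun w => f w * Complex.exp (-g w)) 0 w := fun w => by
    refine ((hf w).hasDerivAt.mul (hg' w).neg.cexp).congr_deriv ?_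
    have := h0 w
    field_simp
    ring
  have hc := is_const_of_deriv_eq_zero (fun w => (hd w).differentiableAt) (fun w => (hd w).deriv) v 0
  have h1 : f v * Complex.exp (-g v) = 1 := by
    rw [hc, hg.1, Complex.exp_neg, Complex.exp_log (h0 0), mul_inv_cancel₀ (h0 0)]
  rwa [Complex.exp_neg, mul_inv_eq_one₀ (Complex.exp_ne_zero _)] at h1

theorem EntireUnits.differentiable_eval (f : EntireUnits) : Differentiable ℂ f.eval :=
  (f : entireRing).2

theorem EntireUnits.eval_mul (f g : EntireUnits) (v : ℂ) :
    (f * g).eval v = f.eval v * g.eval v := rfl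

theorem EntireUnits.eval_one (v : ℂ) : (1 : EntireUnits).eval v = 1 := rfl

theorem EntireUnits.eval_translateUnits (w : ℂ) (f : EntireUnits) (v : ℂ) :
    (translateUnits w f).eval v = f.eval (v + w) := rfl

theorem EntireUnits.eval_ne_zero (f : EntireUnits) (v : ℂ) : f.eval v ≠ 0 := by
  intro h
  have := EntireUnits.eval_mul f f⁻¹ v
  rw [mul_inv_cancel, h, zero_mul, EntireUnits.eval_one] at this
  exact one_ne_zero this

theorem EntireUnits.ext {f g : EntireUnits} (h : ∀ v, f.eval v = g.eval v) : f = g :=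
  Units.ext (Subtype.ext (funext h))

theorem EntireUnits.exists_eval_eq {f : ℂ → ℂ} (hf : Differentiable ℂ f) (h0 : ∀ v, f v ≠ 0) :
    ∃ u : EntireUnits, u.eval = f :=
  ⟨⟨⟨f, hf⟩, ⟨fun v => (f v)⁻¹, hf.inv h0⟩,
    Subtype.ext (funext fun v => mul_inv_cancel₀ (h0 v)),
    Subtype.ext (funext fun v => inv_mul_cancel₀ (h0 v))⟩, rfl⟩

theorem IsThetaFor.ne_zero {ω₁ ω₂ : ℝ} (hω : LinearIndependent ℤ ![ω₁, ω₂])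
    {A : pseudolattice ω₁ ω₂ → EntireUnits} {Θ : ℂ → ℂ} (hΘ : IsThetaFor A Θ) (hne : Θ ≠ 0)
    (z : ℂ) : Θ z ≠ 0 := by
  refine fun hz => hne (funext (eq_const_of_eq_on_pseudolattice hω hΘ.1 z 0 fun a b => ?_))
  simpa [hz] using hΘ.2 ⟨_, mem_pseudolattice ω₁ ω₂ a b⟩ z

theorem IsThetaFor.twist {G : AddSubgroup ℂ} {A : G → EntireUnits} {Θ : ℂ → ℂ}
    (hΘ : IsThetaFor A Θ) (h : EntireUnits) :
    IsThetaFor (QuantumTheta.twist h A) (fun v => Θ v * h.eval v) := by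
  refine ⟨hΘ.1.mul h.differentiable_eval, fun l v => ?_⟩
  have e : (QuantumTheta.twist h A l).eval v * h.eval v = (A l).eval v * h.eval (v + l) := by
    rw [← EntireUnits.eval_mul, QuantumTheta.twist, div_mul_cancel, EntireUnits.eval_mul,
      EntireUnits.eval_translateUnits]
  linear_combination h.eval (v + l) * hΘ.2 l v - Θ v * e

theorem isNormalized_one (ω₁ ω₂ : ℝ) : IsNormalized ω₁ ω₂ 1 :=
  ⟨1, 0, fun l a b _ v => by simp [EntireUnits.eval_one]⟩

/-- With no zeros, `Θ` is itself a unit whose coboundary is `A`, so `h = Θ⁻¹` works. -/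
theorem exists_twist_eq_one {G : AddSubgroup ℂ} {A : G → EntireUnits} {Θ : ℂ → ℂ}
    (hΘ : IsThetaFor A Θ) (h0 : ∀ v, Θ v ≠ 0) : ∃ h : EntireUnits, twist h A = 1 := by
  obtain ⟨u, hu⟩ := EntireUnits.exists_eval_eq hΘ.1 h0
  refine ⟨u⁻¹, funext fun l => ?_⟩
  have e : translateUnits (l : ℂ) u = A l * u := EntireUnits.ext fun v => by
    rw [EntireUnits.eval_translateUnits, EntireUnits.eval_mul, hu, hΘ.2]
  rw [twist, map_inv, e, Pi.one_apply, mul_inv, mul_inv_cancel_left, div_self']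

/-- The quasi-periodicity of the logarithmic derivative of a theta function with exponential
multipliers. -/
theorem deriv_log_add {g : ℂ → ℂ} (hg : Differentiable ℂ g) {l m p q : ℂ}
    (h : ∀ v, Complex.exp (g (v + l)) = m * Complex.exp (p + q * v) * Complex.exp (g v)) (v : ℂ) :
    deriv g (v + l) = deriv g v + q := by
  have h1 : HasDerivAt (fun v => Complex.exp (g (v + l)))
      (Complex.exp (g (v + l)) * deriv g (v + l)) v :=
    ((hg (v + l)).hasDerivAt.comp_add_const v l).cexp
  have h2 : HasDerivAt (fun v => m * Complex.exp (p + q * v) * Complex.exp (g v))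
      (Complex.exp (g (v + l)) * (deriv g v + q)) v := by
    refine (((((hasDerivAt_id v).const_mul q).const_add p).cexp.const_mul m).mul
      (hg v).hasDerivAt.cexp).congr_deriv ?_
    rw [h]
    simp only [id]
    ring
  rw [← funext h] at h2
  exact mul_left_cancel₀ (Complex.exp_ne_zero _) (h1.unique h2)

/-- A continuous function on `ℝ` with a nonzero period has no nonzero additive quasi-period. -/
theorem quasiperiod_eq_zero {f : ℝ → ℂ} (hf : Continuous f) {ω₁ ω₂ : ℝ} (h₁ : ω₁ ≠ 0)
    (hp : Function.Periodic f ω₁) {k : ℂ} (hq : ∀ b : ℤ, f (b * ω₂) = f 0 + b * k) : k = 0 := by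
  obtain ⟨C, hC⟩ := (hp.compact_of_continuous h₁ hf).isBounded.exists_norm_le
  by_contra hk
  -- For this `n`, `‖f 0 + n * k‖` exceeds the bound `C`.
  obtain ⟨n, hn⟩ := exists_nat_gt ((C + ‖f 0‖) / ‖k‖)
  rw [div_lt_iff₀ (norm_pos_iff.2 hk)] at hn
  have h1 := hC _ ⟨_, hq n⟩
  have h2 := norm_sub_le (f 0 + (n : ℤ) * k) (f 0)
  rw [add_sub_cancel_left, norm_mul] at h2
  simp only [Int.cast_natCast, Complex.norm_natCast] at h1 h2
  linarith

theorem eq_exp_of_deriv_const {g : ℂ → ℂ} (hg : Differentiable ℂ g) {k : ℂ}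
    (h : ∀ v, deriv g v = k) (v : ℂ) : g v = g 0 + k * v := by
  have hd : ∀ w, HasDerivAt (fun w => g w - k * w) 0 w := fun w =>
    ((hg w).hasDerivAt.sub ((hasDerivAt_id w).const_mul k)).congr_deriv (by simp [h])
  have := is_const_of_deriv_eq_zero (fun w => (hd w).differentiableAt) (fun w => (hd w).deriv) v 0
  linear_combination this

theorem IsNormalized.theta_eq_exp {ω₁ ω₂ : ℝ} (hω : LinearIndependent ℤ ![ω₁, ω₂])
    {B : pseudolattice ω₁ ω₂ → EntireUnits} (hB : IsNormalized ω₁ ω₂ B) {F : ℂ → ℂ}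
    (hF : IsThetaFor B F) (h0 : ∀ v, F v ≠ 0) :
    ∃ (c : ℂ) (α : ℝ), c ≠ 0 ∧ ∀ v, F v = c * Complex.exp (2 * Real.pi * Complex.I * α * v) := by
  obtain ⟨μ, s, hμ⟩ := hB
  have h₁ := left_ne_zero_of_linearIndependent hω
  obtain ⟨g, hg, hFg⟩ := exists_entire_log hF.1 h0
  set K : ℂ := s * (Real.pi * Complex.I / ω₁)
  have hq : ∀ (a b : ℤ) (v : ℂ), deriv g (v + (a * ω₁ + b * ω₂)) = deriv g v + b * (2 * K) := by
    intro a b v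
    refine deriv_log_add hg (m := (μ ⟨_, mem_pseudolattice ω₁ ω₂ a b⟩ : ℂ))
      (p := K * (b ^ 2 * ω₂)) (fun w => ?_) v
    rw [← hFg, ← hFg, hF.2 ⟨_, mem_pseudolattice ω₁ ω₂ a b⟩ w, hμ _ a b rfl w]
    congr 3
    ring
  -- On `ℝ`, `g'` has period `ω₁` and gains `2 * K` under each shift by `ω₂`.
  have hK : 2 * K = 0 := by
    refine quasiperiod_eq_zero (f := fun x : ℝ => deriv g x) (ω₂ := ω₂)
      (hg.deriv.continuous.comp Complex.continuous_ofReal) h₁ (fun x => ?_) (fun b => ?_)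
    · simpa using hq 1 0 x
    · simpa using hq 0 b 0
  have hconst : ∀ v, deriv g v = deriv g 0 :=
    eq_const_of_eq_on_pseudolattice hω hg.deriv 0 _ fun a b => by rw [hq, hK, mul_zero, add_zero]
  have hlin := eq_exp_of_deriv_const hg hconst
  -- Compare absolute values under the shift by `ω₁`: there `b = 0`, so the multiplier is just `μ`,
  -- of modulus `1`.
  have hre : (deriv g 0).re = 0 := by
    have hper := hF.2 ⟨_, mem_pseudolattice ω₁ ω₂ 1 0⟩ 0
    rw [hμ _ 1 0 rfl, hFg, hFg, hlin (0 + _)] at hper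
    have hn := congrArg (‖·‖) hper
    rw [norm_mul, norm_mul, Circle.norm_coe] at hn
    simp [Complex.norm_exp] at hn
    exact hn.resolve_right h₁
  refine ⟨Complex.exp (g 0), (deriv g 0).im / (2 * Real.pi), Complex.exp_ne_zero _, fun v => ?_⟩
  have hk : deriv g 0 = (deriv g 0).im * Complex.I := by
    apply Complex.ext <;> simp [hre]
  rw [hFg, hlin, Complex.exp_add, hk]
  congr 2
  have := Complex.ofReal_ne_zero.2 Real.pi_ne_zero
  push_cast
  field_simp
  simp [mul_comm]

end QuantumTheta

theorem mainTheorem3 (ω₁ ω₂ : ℝ) (hω : LinearIndependent ℤ ![ω₁, ω₂])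
    (A : QuantumTheta.pseudolattice ω₁ ω₂ → QuantumTheta.EntireUnits)
    (hA : A ∈ QuantumTheta.cocycles (QuantumTheta.pseudolattice ω₁ ω₂))
    (Θ : ℂ → ℂ) (hΘ : QuantumTheta.IsThetaFor A Θ) (hne : Θ ≠ 0) :
    QuantumTheta.IsTrivialTheta Θ ∧
    (∃ h : QuantumTheta.EntireUnits,
      QuantumTheta.IsNormalized ω₁ ω₂ (QuantumTheta.twist h A)) ∧
    (∀ h : QuantumTheta.EntireUnits,
      QuantumTheta.IsNormalized ω₁ ω₂ (QuantumTheta.twist h A) →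
        ∃ (c : ℂ) (α : ℝ), c ≠ 0 ∧
          ∀ v : ℂ, Θ v * h.eval v = c * Complex.exp (2 * Real.pi * Complex.I * α * v)) := by
  have h0 := hΘ.ne_zero hω hne
  refine ⟨?_, ?_, fun h hB => hB.theta_eq_exp hω (hΘ.twist h)
    fun v => mul_ne_zero (h0 v) (h.eval_ne_zero v)⟩
  · obtain ⟨g, hg, hΘg⟩ := QuantumTheta.exists_entire_log hΘ.1 h0
    exact ⟨1, g, one_ne_zero, hg, fun v => by rw [one_mul, hΘg]⟩
  · obtain ⟨h, hh⟩ := QuantumTheta.exists_twist_eq_one hΘ h0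
    exact ⟨h, hh ▸ QuantumTheta.isNormalized_one ω₁ ω₂⟩
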